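/- Let $k$ be a field and work on $\mathbb{P}^3=\mathbb{P}^3_k$. Given integers $a_1\le\dots\le a_s$ and $0\le b_1\le\dots\le b_{s+1}$, consider monads of the form $$\bigoplus_{i=1}^{s}\mathcal{O}(-a_i-1)\xrightarrow{\ \beta\ }\bigoplus_{j=1}^{s+1}\bigl(\mathcal{O}(b_j)\oplus\mathcal{O}(-b_j-1)\bigr)\xrightarrow{\ \alpha\ }\bigoplus_{i=1}^{s}\mathcal{O}(a_i),$$ that is, $\alpha\circ\beta=0$, $\beta$ is injective and locally left invertible, and $\alpha$ is surjective; the cohomology bundle of the monad is $\mathcal{E}=\ker\alpha/\operatorname{im}\beta$. Write $\mathcal{C},\mathcal{B},\mathcal{A}$ for the left, middle and right terms. The monad is minimal if no nonzero direct summand of $\mathcal{A}$ is the image under $\alpha$ of a line subbundle of $\mathcal{B}$, and no nonzero direct summand of $\mathcal{C}$ is mapped by $\beta$ onto a direct summand of $\mathcal{B}$. A bundle $\mathcal{E}$ is stable if $c_1(\mathcal{F})/\operatorname{rk}\mathcal{F}<c_1(\mathcal{E})/\operatorname{rk}\mathcal{E}$ for every coherent subsheaf $\mathcal{F}\subset\mathcal{E}$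 with $0<\operatorname{rk}\mathcal{F}<\operatorname{rk}\mathcal{E}$. Then there is no minimal monad of this form with stable cohomology bundle in any of the following three cases: 1. (type (P5)) $\boldsymbol{a}=(2,2)$ and $\boldsymbol{b}=(0,0,2)$; 2. (type (P11)) $\boldsymbol{a}=(1,2,2)$ and $\boldsymbol{b}=(0,0,0,2)$; 3. (type (P18)) $\boldsymbol{a}=(2,2,2)$ and $\boldsymbol{b}=(0,1,1,2)$. -/

import Mathlib

universe u

open CategoryTheory CategoryTheory.Limits TopologicalSpace Opposite

namespace AlgebraicGeometry

noncomputable section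

namespace SerreTwist

section General

variable {A : Type u} [CommRing A] {σ : Type*} [SetLike σ A] [AddSubgroupClass σ A]
variable (𝒜 : ℕ → σ) [GradedRing 𝒜]

variable {𝒜} in
/-- The complement of the homogeneous prime corresponding to a point of `Proj A`. -/
abbrev compl (x : ProjectiveSpectrum 𝒜) : Submonoid A :=
  x.asHomogeneousIdeal.toIdeal.primeCompl

/-- The localization `A_𝔭` at the homogeneous prime `𝔭` corresponding to a point of `Proj A`. -/
abbrev Fiber (x : ProjectiveSpectrum 𝒜) : Type u :=
  Localization (compl x)

variable {𝒜} in
/-- `f` is given on `U` by one fraction `r / s` with `r`, `s` homogeneous and `deg r - deg s = d`. -/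
def IsFraction (d : ℤ) {U : Opens (ProjectiveSpectrum.top 𝒜)} (f : ∀ x : U, Fiber 𝒜 x.1) : Prop :=
  ∃ (i j : ℕ) (_ : (i : ℤ) = j + d) (r : 𝒜 i) (s : 𝒜 j) (hs : ∀ x : U, (s : A) ∈ compl x.1),
    ∀ x : U, f x = Localization.mk (r : A) ⟨(s : A), hs x⟩

/-- Being a fraction of degree `d` is stable under restriction. -/
def isFractionPrelocal (d : ℤ) :
    TopCat.PrelocalPredicate (X := ProjectiveSpectrum.top 𝒜) (fun x => Fiber 𝒜 x) where
  pred f := IsFraction d f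
  res := by
    rintro V U i f ⟨a, b, e, r, s, h, w⟩
    exact ⟨a, b, e, r, s, fun x => h (i x), fun x => w (i x)⟩

/-- Being locally a fraction of degree `d`. -/
def isLocallyFraction (d : ℤ) :
    TopCat.LocalPredicate (X := ProjectiveSpectrum.top 𝒜) (fun x => Fiber 𝒜 x) :=
  (isFractionPrelocal 𝒜 d).sheafify

/-- Every point has a homogeneous element of positive degree not vanishing at it. -/
theorem exists_homogeneous_mem_compl (x : ProjectiveSpectrum 𝒜) :
    ∃ (m : ℕ) (_ : 0 < m) (s : 𝒜 m), (s : A) ∈ compl x := by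
  classical
  by_contra! H
  apply x.not_irrelevant_le
  intro z hz
  rw [← DirectSum.sum_support_decompose 𝒜 z]
  refine Ideal.sum_mem _ fun c hc => ?_
  rcases Nat.eq_zero_or_pos c with hc0 | hc0
  · have h0 : (DirectSum.decompose 𝒜 z c : A) = 0 := by
      subst hc0; exact hz
    rw [h0]; exact Ideal.zero_mem _
  · by_contra hh
    exact H c hc0 (DirectSum.decompose 𝒜 z c) hh

variable {𝒜} in
/-- The sections of `𝒪(d)` over `U`: the functions `x ↦ f(x) ∈ A_𝔭` that are locally
homogeneous fractions of degree `d`. -/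
def sections (d : ℤ) (U : Opens (ProjectiveSpectrum.top 𝒜)) :
    AddSubgroup (∀ x : U, Fiber 𝒜 x.1) where
  carrier := {f | (isLocallyFraction 𝒜 d).pred f}
  zero_mem' x := by
    obtain ⟨m, hm, s, hs⟩ := exists_homogeneous_mem_compl 𝒜 x.1
    have hn : (0 : ℤ) ≤ ((d.natAbs • m : ℕ) : ℤ) + d := by
      have h1 : d.natAbs ≤ d.natAbs • m := Nat.le_mul_of_pos_right _ hm
      omega
    refine ⟨U ⊓ ProjectiveSpectrum.basicOpen 𝒜 (s : A), ⟨x.2, hs⟩, Opens.infLELeft _ _,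
      (((d.natAbs • m : ℕ) : ℤ) + d).toNat, d.natAbs • m, Int.toNat_of_nonneg hn, 0,
      ⟨(s : A) ^ d.natAbs, SetLike.pow_mem_graded _ s.2⟩,
      fun y => (compl y.1).pow_mem y.2.2 _, fun y => ?_⟩
    exact (Localization.mk_zero _).symm
  add_mem' {a b} ha hb x := by
    obtain ⟨Va, ma, ia, i, j, e, r, s, h, w⟩ := ha x
    obtain ⟨Vb, mb, ib, i', j', e', r', s', h', w'⟩ := hb x
    refine ⟨Va ⊓ Vb, ⟨ma, mb⟩, Opens.infLELeft _ _ ≫ ia, j + i', j + j', ?_,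
      ⟨(s : A) * r' + s' * r, ?_⟩, ⟨(s : A) * s', SetLike.mul_mem_graded s.2 s'.2⟩, ?_, ?_⟩
    · push_cast; omega
    · refine add_mem (SetLike.mul_mem_graded s.2 r'.2) ?_
      have : j + i' = j' + i := by omega
      rw [this]
      exact SetLike.mul_mem_graded s'.2 r.2
    · intro y
      exact (compl y.1).mul_mem (h ⟨y.1, y.2.1⟩) (h' ⟨y.1, y.2.2⟩)
    · intro y
      exact (congrArg₂ (· + ·) (w ⟨y.1, y.2.1⟩) (w' ⟨y.1, y.2.2⟩)).trans (Localization.add_mk ..)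
  neg_mem' {a} ha x := by
    obtain ⟨Va, ma, ia, i, j, e, r, s, h, w⟩ := ha x
    refine ⟨Va, ma, ia, i, j, e, ⟨-r, neg_mem r.2⟩, s, h, fun y => ?_⟩
    exact (congrArg (- ·) (w y)).trans (Localization.neg_mk ..)

/-- `𝒪(d)` as a sheaf of types. -/
def sheafInType (d : ℤ) : TopCat.Sheaf (Type u) (ProjectiveSpectrum.top 𝒜) :=
  TopCat.subsheafToTypes (isLocallyFraction 𝒜 d)

instance (d : ℤ) (U : (Opens (ProjectiveSpectrum.top 𝒜))ᵒᵖ) :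
    AddCommGroup ((sheafInType 𝒜 d).obj.obj U) :=
  (sections d U.unop).toAddCommGroup

/-- `𝒪(d)` as a presheaf of abelian groups. -/
def abPresheaf (d : ℤ) : TopCat.Presheaf Ab.{u} (ProjectiveSpectrum.top 𝒜) where
  obj U := .of ((sheafInType 𝒜 d).obj.obj U)
  map i := AddCommGrpCat.ofHom
    { toFun := (sheafInType 𝒜 d).obj.map i
      map_zero' := rfl
      map_add' := fun _ _ => rfl }

variable {𝒜} in
/-- The product of a section of the structure sheaf and a section of `𝒪(d)`. -/
def smulSection {d : ℤ} {U : (Opens (ProjectiveSpectrum.top 𝒜))ᵒᵖ}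
    (a : (ProjectiveSpectrum.Proj.structureSheaf 𝒜).obj.obj U) (f : (sheafInType 𝒜 d).obj.obj U) :
    (sheafInType 𝒜 d).obj.obj U :=
  ⟨fun x => HomogeneousLocalization.val (a.1 x) * f.1 x, fun x => by
    obtain ⟨Va, ma, ia, i, r, s, h, w⟩ := a.2 x
    obtain ⟨Vb, mb, ib, i', j', e', r', s', h', w'⟩ := f.2 x
    refine ⟨Va ⊓ Vb, ⟨ma, mb⟩, Opens.infLELeft _ _ ≫ ia, i + i', i + j', ?_,
      ⟨(r : A) * r', SetLike.mul_mem_graded r.2 r'.2⟩,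
      ⟨(s : A) * s', SetLike.mul_mem_graded s.2 s'.2⟩, ?_, ?_⟩
    · push_cast; omega
    · intro y
      exact (compl y.1).mul_mem (h ⟨y.1, y.2.1⟩) (h' ⟨y.1, y.2.2⟩)
    · intro y
      exact (congrArg₂ (fun u v => HomogeneousLocalization.val u * v)
        (w ⟨y.1, y.2.1⟩) (w' ⟨y.1, y.2.2⟩)).trans (Localization.mk_mul ..)⟩

/-- The sections of the structure sheaf act on those of `𝒪(d)` by pointwise multiplication. -/
instance (d : ℤ) (U : (Opens (ProjectiveSpectrum.top 𝒜))ᵒᵖ) :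
    Module ((ProjectiveSpectrum.Proj.structureSheaf 𝒜).obj.obj U)
      ((sheafInType 𝒜 d).obj.obj U) where
  smul a f := smulSection a f
  one_smul f := Subtype.ext <| funext fun x =>
    (congrArg (· * f.1 x) HomogeneousLocalization.val_one).trans (one_mul _)
  mul_smul a b f := Subtype.ext <| funext fun x =>
    (congrArg (· * f.1 x) (HomogeneousLocalization.val_mul (a.1 x) (b.1 x))).trans (mul_assoc _ _ _)
  smul_zero a := Subtype.ext <| funext fun x => mul_zero (HomogeneousLocalization.val (a.1 x))
  smul_add a f g := Subtype.ext <| funext fun x =>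
    mul_add (HomogeneousLocalization.val (a.1 x)) (f.1 x) (g.1 x)
  add_smul a b f := Subtype.ext <| funext fun x =>
    (congrArg (· * f.1 x) (HomogeneousLocalization.val_add (a.1 x) (b.1 x))).trans (add_mul _ _ _)
  zero_smul f := Subtype.ext <| funext fun x =>
    (congrArg (· * f.1 x) HomogeneousLocalization.val_zero).trans (zero_mul _)

/-- The same action, stated for the ring-valued structure sheaf used by `Scheme.Modules`. -/
abbrev moduleSections (d : ℤ) (U : (Opens (ProjectiveSpectrum.top 𝒜))ᵒᵖ) :
    Module ((Proj 𝒜).ringCatSheaf.obj.obj U) ((abPresheaf 𝒜 d).obj U) :=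
  inferInstanceAs (Module ((ProjectiveSpectrum.Proj.structureSheaf 𝒜).obj.obj U)
    ((sheafInType 𝒜 d).obj.obj U))

/-- `𝒪(d)` as a presheaf of modules over the structure sheaf. -/
def modulePresheaf (d : ℤ) : (Proj 𝒜).PresheafOfModules :=
  @PresheafOfModules.ofPresheaf _ _ (Proj 𝒜).ringCatSheaf.obj (abPresheaf 𝒜 d)
    (moduleSections 𝒜 d)
    (fun _ _ _ _ _ => rfl)

/-- Serre's twisting sheaf `𝒪(d)` on `Proj A`. -/
def twist (d : ℤ) : (Proj 𝒜).Modules where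
  val := modulePresheaf 𝒜 d
  isSheaf := (TopCat.Presheaf.isSheaf_iff_isSheaf_comp (forget AddCommGrpCat) _).2
    (sheafInType 𝒜 d).2

end General

end SerreTwist

attribute [local instance] MvPolynomial.gradedAlgebra
attribute [local instance] Abelian.hasFiniteBiproducts

/-- Projective three-space over `k`. -/
abbrev P3 (k : Type u) [Field k] : Scheme.{u} :=
  Proj (MvPolynomial.homogeneousSubmodule (Fin 4) k)

namespace P3

variable (k : Type u) [Field k]

/-- The line bundle `𝒪(d)` on `ℙ³`. -/
abbrev O (d : ℤ) : (P3 k).Modules :=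
  SerreTwist.twist (MvPolynomial.homogeneousSubmodule (Fin 4) k) d

/-- The finite direct sum of the line bundles `𝒪(d i)`. -/
abbrev split {ι : Type} [Finite ι] (d : ι → ℤ) : (P3 k).Modules :=
  ⨁ fun i => O k (d i)

variable {k}

/-- `F` is a coherent sheaf on `ℙ³` of rank `r` with first Chern class `c` (an integer, via
`c₁(𝒪(1)) = 1`). Rank and `c₁` are the additive functions on the Grothendieck group of coherent
sheaves with values `1` and `d` on `𝒪(d)`; they are computed here from any bounded complex
of finite direct sums of line bundles whose only nonzero cohomology sheaf is `F`, placed in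
degree `0`. By the syzygy theorem every coherent sheaf on `ℙ³` has such a complex (a finite
resolution), and conversely the cohomology of such a complex is coherent; `d i` lists the degrees
of the summands in position `i`. -/
def HasRankAndC1 (F : (P3 k).Modules) (r c : ℤ) : Prop :=
  ∃ (K : CochainComplex (P3 k).Modules ℤ) (N : ℕ) (d : ℤ → List ℤ),
    (∀ i, Nonempty (K.X i ≅ split k (d i).get)) ∧
    (∀ i : ℤ, i ∉ Finset.Icc (-(N : ℤ)) N → d i = []) ∧
    (∀ i : ℤ, i ≠ 0 → K.ExactAt i) ∧
    Nonempty (K.homology 0 ≅ F) ∧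
    r = ∑ i ∈ Finset.Icc (-(N : ℤ)) N, (i.negOnePow : ℤ) * (d i).length ∧
    c = ∑ i ∈ Finset.Icc (-(N : ℤ)) N, (i.negOnePow : ℤ) * (d i).sum

/-- Slope stability (Mumford--Takemoto) of a coherent torsion-free sheaf `E`, in particular of a
vector bundle: `c₁(F) / rk F < c₁(E) / rk E` for every coherent subsheaf `F` of `E` with
`0 < rk F < rk E`. -/
def IsStable (E : (P3 k).Modules) : Prop :=
  (∃ r c : ℤ, HasRankAndC1 E r c) ∧
  ∀ r c : ℤ, HasRankAndC1 E r c →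
    ∀ (F : (P3 k).Modules) (i : F ⟶ E), Mono i →
      ∀ s e : ℤ, HasRankAndC1 F s e → 0 < s → s < r → e * r < c * s

/-- A morphism of `𝒪`-modules that is locally left invertible: every point has an open
neighbourhood over which the morphism has a left inverse. -/
def IsLocallyLeftInvertible {M N : (P3 k).Modules} (f : M ⟶ N) : Prop :=
  ∀ x : P3 k, ∃ U : (P3 k).Opens, x ∈ U ∧
    IsSplitMono ((Scheme.Modules.restrictFunctor U.ι).map f)

/-- The image of `f` is a nonzero direct summand of the target of `f`. -/
def ImageIsSummand {M N : (P3 k).Modules} (f : M ⟶ N) : Prop :=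
  ¬ IsZero (image f) ∧ IsSplitMono (image.ι f)

variable (k) in
/-- A monad
`⨁ᵢ 𝒪(-aᵢ-1) --β--> ⨁ⱼ (𝒪(bⱼ) ⊕ 𝒪(-bⱼ-1)) --α--> ⨁ᵢ 𝒪(aᵢ)`
on `ℙ³`: `α ∘ β = 0`, `β` is injective and locally left invertible, and `α` is surjective. -/
structure Monad {s : ℕ} (a : Fin s → ℤ) (b : Fin (s + 1) → ℤ) where
  /-- the left-hand morphism -/
  β : split k (fun i => -a i - 1) ⟶ split k (Sum.elim b fun j => -b j - 1)
  /-- the right-hand morphism -/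
  α : split k (Sum.elim b fun j => -b j - 1) ⟶ split k a
  comp_eq_zero : β ≫ α = 0
  mono_β : Mono β
  locallyLeftInvertible_β : IsLocallyLeftInvertible β
  epi_α : Epi α

namespace Monad

variable {s : ℕ} {a : Fin s → ℤ} {b : Fin (s + 1) → ℤ}

/-- The cohomology bundle `ker α / im β` of a monad. -/
def cohomology (M : Monad k a b) : (P3 k).Modules :=
  (ShortComplex.mk M.β M.α M.comp_eq_zero).homology

/-- A monad is minimal if no (nonzero) direct summand of the right-hand term is the image of a line
subbundle of the middle term, and no (nonzero) direct summand of the left-hand term goes onto a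
direct summand of the middle term. Line subbundles are the locally left invertible morphisms from
some `𝒪(m)`, as every line bundle on `ℙ³` is isomorphic to one of these. -/
def IsMinimal (M : Monad k a b) : Prop :=
  (∀ (m : ℤ) (j : O k m ⟶ split k (Sum.elim b fun l => -b l - 1)),
    IsLocallyLeftInvertible j → ¬ ImageIsSummand (j ≫ M.α)) ∧
  (∀ (D : (P3 k).Modules) (p : D ⟶ split k (fun i => -a i - 1)),
    IsSplitMono p → ¬ ImageIsSummand (p ≫ M.β))

end Monad

end P3

end

end AlgebraicGeometry

/-!
In all three cases the middle term of the monad has a summand `𝒪(2)`, and `2` is the largest of the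
degrees `aᵢ`. The restriction of `α` to this summand has components in `Hom(𝒪(2), 𝒪(aᵢ))`, which is
zero for `aᵢ < 2` and consists of constants for `aᵢ = 2`. If one of the components were nonzero, the
image of `𝒪(2)` would be a direct summand of the right-hand term, against minimality. So `𝒪(2)`
lies in `ker α` (`P3.ι_comp_eq_zero`), and it meets the image of `β` trivially because all summands
of the left-hand term have negative degree and `β` is locally split (`P3.eq_zero_of_comp_ι_eq`).
Hence `𝒪(2)` is a subsheaf of the cohomology bundle, which has rank `2` and first Chern class `-1`
(`P3.Monad.hasRankAndC1_cohomology`), and its slope `2` exceeds the slope `-1/2` of the bundle.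

Morphisms between line bundles, also over open subschemes, are handled through their values at the
generic point: such a morphism `𝒪(d) ⟶ 𝒪(e)` is multiplication by an element of the fraction field
of the coordinate ring (`P3.exists_isMultiplier`), regular of degree `e - d` at each point of the
open subscheme (`P3.IsMultiplier.isRegularAt`). An element that is regular everywhere is a
polynomial, because the coordinate ring is factorial (`P3.exists_polynomial_of_isRegularAt`).
Morphisms between sums of line bundles become matrices over the fraction field.
-/

namespace AlgebraicGeometry

noncomputable section

attribute [local instance] MvPolynomial.gradedAlgebra
attribute [local instance] Abelian.hasFiniteBiproducts

namespace P3

variable {k : Type u} [Field k]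

open Scheme.Modules

/-! ### Rational functions that are regular of a given degree -/

variable (k) in
/-- The grading of the homogeneous coordinate ring of `ℙ³` by degree. -/
abbrev coordGrading : ℕ → Submodule k (MvPolynomial (Fin 4) k) :=
  MvPolynomial.homogeneousSubmodule (Fin 4) k

variable (k) in
/-- The fraction field of the homogeneous coordinate ring of `ℙ³`. -/
abbrev FracField : Type u :=
  FractionRing (MvPolynomial (Fin 4) k)

/-- The element `h` of the fraction field is a fraction of homogeneous polynomials, of degree `m`,
whose denominator does not vanish at the point `x`. -/
def IsRegularAt (m : ℤ) (x : ProjectiveSpectrum (coordGrading k)) (h : FracField k) : Prop :=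
  ∃ (i j : ℕ) (r s : MvPolynomial (Fin 4) k), (i : ℤ) = j + m ∧ r.IsHomogeneous i ∧
    s.IsHomogeneous j ∧ s ∈ SerreTwist.compl x ∧
    h = algebraMap _ (FracField k) r / algebraMap _ (FracField k) s

theorem compl_le_nonZeroDivisors (x : ProjectiveSpectrum (coordGrading k)) :
    SerreTwist.compl x ≤ nonZeroDivisors (MvPolynomial (Fin 4) k) :=
  Ideal.primeCompl_le_nonZeroDivisors _

theorem algebraMap_ne_zero_of_mem_compl {x : ProjectiveSpectrum (coordGrading k)}
    {s : MvPolynomial (Fin 4) k} (hs : s ∈ SerreTwist.compl x) :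
    algebraMap _ (FracField k) s ≠ 0 :=
  IsFractionRing.to_map_ne_zero_of_mem_nonZeroDivisors (compl_le_nonZeroDivisors x hs)

/-- The coordinates have no common zero on `ℙ³`: they generate the irrelevant ideal. -/
theorem exists_X_mem_compl (x : ProjectiveSpectrum (coordGrading k)) :
    ∃ i : Fin 4, (MvPolynomial.X i : MvPolynomial (Fin 4) k) ∈ SerreTwist.compl x := by
  by_contra! H
  obtain ⟨m, hm, s, hs⟩ := SerreTwist.exists_homogeneous_mem_compl (coordGrading k) x
  have hX : ∀ i, (MvPolynomial.X i : MvPolynomial (Fin 4) k) ∈ x.asHomogeneousIdeal.toIdeal :=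
    fun i => not_not.1 (H i)
  refine hs ?_
  have hle : Ideal.span (MvPolynomial.X '' (Set.univ : Set (Fin 4))) ≤
      x.asHomogeneousIdeal.toIdeal := by
    rw [Ideal.span_le]
    rintro _ ⟨i, -, rfl⟩
    exact hX i
  refine hle ?_
  rw [MvPolynomial.mem_ideal_span_X_image]
  intro d hd
  have hdeg := s.2.degree_eq_sum_deg_support hd
  by_contra! h0
  have : d = 0 := by
    ext i
    exact h0 i (Set.mem_univ i)
  subst this
  simp at hdeg
  omega

/-- The reduced denominator of `h` divides the denominators of all its local expressions. It is a
unit: otherwise the largest homogeneous ideal inside the prime ideal of one of its prime factors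
would be a point of `ℙ³` where `h` is not regular. -/
theorem exists_polynomial_of_isRegularAt {m : ℤ} {h : FracField k}
    (hh : ∀ x, IsRegularAt m x h) :
    ∃ p : MvPolynomial (Fin 4) k, h = algebraMap _ (FracField k) p := by
  obtain ⟨a, b, hab, rfl⟩ := IsFractionRing.exists_reduced_fraction (MvPolynomial (Fin 4) k) h
  have hb0 : (b : MvPolynomial (Fin 4) k) ≠ 0 := nonZeroDivisors.ne_zero b.2
  have hdvd : ∀ r s : MvPolynomial (Fin 4) k, s ≠ 0 →
      IsLocalization.mk' (FracField k) a b = algebraMap _ (FracField k) r /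
        algebraMap _ (FracField k) s → (b : MvPolynomial (Fin 4) k) ∣ s := by
    intro r s hs he
    have hs' : algebraMap _ (FracField k) s ≠ 0 := by simp [hs]
    have hb' : algebraMap _ (FracField k) (b : MvPolynomial (Fin 4) k) ≠ 0 := by simp
    rw [IsFractionRing.mk'_eq_div, div_eq_div_iff hb' hs', ← map_mul, ← map_mul] at he
    have he' := IsFractionRing.injective (MvPolynomial (Fin 4) k) (FracField k) he
    exact hab.symm.dvd_of_dvd_mul_left ⟨r, by rw [he', mul_comm]⟩
  suffices hu : IsUnit (b : MvPolynomial (Fin 4) k) by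
    obtain ⟨u, hu⟩ := hu
    refine ⟨a * ↑u⁻¹, ?_⟩
    rw [IsFractionRing.mk'_eq_div, ← hu, map_mul, div_eq_iff (by simp), mul_assoc, ← map_mul]
    simp
  by_contra hu
  obtain ⟨π, hπ, hπb⟩ := WfDvdMonoid.exists_irreducible_factor hu hb0
  have hπ : Prime π := hπ.prime
  have hprime : (Ideal.span {π}).IsPrime := (Ideal.span_singleton_prime hπ.ne_zero).2 hπ
  have hX : ∀ i : Fin 4, (MvPolynomial.X i : MvPolynomial (Fin 4) k) ∈ Ideal.span {π} →
      Associated π (MvPolynomial.X i) := fun i hi =>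
    hπ.associated_of_dvd (MvPolynomial.X_prime) (Ideal.mem_span_singleton.1 hi)
  obtain ⟨i, j, r, s, -, -, hs, hsx, he⟩ := hh
    ⟨(Ideal.span {π}).homogeneousCore (coordGrading k), hprime.homogeneousCore, fun hle => by
      have hmem : ∀ i : Fin 4,
          (MvPolynomial.X i : MvPolynomial (Fin 4) k) ∈ Ideal.span {π} := fun i => by
        refine Ideal.toIdeal_homogeneousCore_le (coordGrading k) _ (hle ?_)
        refine HomogeneousIdeal.mem_irrelevant_of_mem _ one_pos (MvPolynomial.isHomogeneous_X k i)
      -- The point is relevant because `π` cannot be associated to two coordinates.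
      have h01 := (hX 0 (hmem 0)).symm.trans (hX 1 (hmem 1))
      exact absurd ((MvPolynomial.X_dvd_X (R := k)).1 h01.dvd) (by decide)⟩
  -- A homogeneous denominator in `(π)` lies in the homogeneous core of `(π)`.
  refine hsx (Ideal.mem_homogeneousCore_of_homogeneous_of_mem ⟨_, hs⟩ ?_)
  exact Ideal.mem_span_singleton.2 (hπb.trans (hdvd r s (fun h0 => hsx (h0 ▸ Ideal.zero_mem _)) he))

variable (k) in
/-- The generic point of `ℙ³`, which is the zero ideal. -/
def genericPt : P3 k :=
  (⟨⊥, inferInstanceAs (⊥ : Ideal (MvPolynomial (Fin 4) k)).IsPrime, fun hle => by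
    have : (MvPolynomial.X 0 : MvPolynomial (Fin 4) k) ∈ (⊥ : Ideal (MvPolynomial (Fin 4) k)) :=
      hle (HomogeneousIdeal.mem_irrelevant_of_mem _ one_pos (MvPolynomial.isHomogeneous_X k 0))
    simp at this⟩ : ProjectiveSpectrum (coordGrading k))

theorem eq_zero_of_isRegularAt_of_neg {m : ℤ} (hm : m < 0) {h : FracField k}
    (hh : ∀ x, IsRegularAt m x h) : h = 0 := by
  obtain ⟨p, rfl⟩ := exists_polynomial_of_isRegularAt hh
  obtain ⟨i, j, r, s, hij, hr, hs, hsx, he⟩ := hh (genericPt k)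
  have hs0 := algebraMap_ne_zero_of_mem_compl hsx
  rw [eq_div_iff hs0, ← map_mul] at he
  have he' := IsFractionRing.injective (MvPolynomial (Fin 4) k) (FracField k) he
  by_contra hp
  have hp : p ≠ 0 := fun h0 => hp (by simp [h0])
  have hs0' : s ≠ 0 := fun h0 => hs0 (by simp [h0])
  have h1 := MvPolynomial.totalDegree_mul_of_isDomain hp hs0'
  rw [he', hr.totalDegree (he' ▸ mul_ne_zero hp hs0'), hs.totalDegree hs0'] at h1
  omega

theorem exists_eq_C_of_isRegularAt_zero {h : FracField k}
    (hh : ∀ x, IsRegularAt 0 x h) :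
    ∃ c : k, h = algebraMap (MvPolynomial (Fin 4) k) (FracField k) (MvPolynomial.C c) := by
  obtain ⟨p, rfl⟩ := exists_polynomial_of_isRegularAt hh
  obtain ⟨i, j, r, s, hij, hr, hs, hsx, he⟩ := hh (genericPt k)
  have hs0 := algebraMap_ne_zero_of_mem_compl hsx
  rw [eq_div_iff hs0, ← map_mul] at he
  have he' := IsFractionRing.injective (MvPolynomial (Fin 4) k) (FracField k) he
  by_cases hp : p = 0
  · exact ⟨0, by simp [hp]⟩
  have hs0' : s ≠ 0 := fun h0 => hs0 (by simp [h0])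
  have h1 := MvPolynomial.totalDegree_mul_of_isDomain hp hs0'
  rw [he', hr.totalDegree (he' ▸ mul_ne_zero hp hs0'), hs.totalDegree hs0'] at h1
  have h2 : p.totalDegree = 0 := by omega
  exact ⟨_, congrArg _ (MvPolynomial.totalDegree_eq_zero_iff_eq_C.1 h2)⟩

/-- The generic point lies in every nonempty open set. -/
theorem genericPt_mem {U : (P3 k).Opens} {x : P3 k} (hx : x ∈ U) : genericPt k ∈ U := by
  have : genericPt k ⤳ x := by
    rw [specializes_iff_mem_closure]
    exact (ProjectiveSpectrum.le_iff_mem_closure (𝒜 := coordGrading k) (genericPt k) x).1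
      (bot_le (a := (x : ProjectiveSpectrum (coordGrading k)).asHomogeneousIdeal))
  exact this.mem_open U.2 hx

/-! ### Values of sections at the generic point -/

/-- The inclusion of the localization at a point into the fraction field. -/
def fiberToField (x : ProjectiveSpectrum (coordGrading k)) :
    SerreTwist.Fiber (coordGrading k) x →+* FracField k :=
  IsLocalization.lift (M := SerreTwist.compl x) (g := algebraMap _ (FracField k))
    fun s => (algebraMap_ne_zero_of_mem_compl s.2).isUnit

theorem fiberToField_mk (x : ProjectiveSpectrum (coordGrading k)) (r : MvPolynomial (Fin 4) k)
    (s : SerreTwist.compl x) : fiberToField x (Localization.mk r s) =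
      algebraMap _ (FracField k) r / algebraMap _ (FracField k) (s : MvPolynomial (Fin 4) k) := by
  rw [fiberToField, Localization.mk_eq_mk', IsLocalization.lift_mk'_spec,
    mul_div_cancel₀ _ (algebraMap_ne_zero_of_mem_compl s.2)]

theorem fiberToField_injective (x : ProjectiveSpectrum (coordGrading k)) :
    Function.Injective (fiberToField x) := by
  rw [injective_iff_map_eq_zero]
  intro f
  induction f using Localization.induction_on with
  | H y =>
    intro hf
    rw [fiberToField_mk, div_eq_zero_iff, or_iff_left (algebraMap_ne_zero_of_mem_compl y.2.2)] at hf
    have : y.1 = 0 := by simpa using hf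
    rw [this, Localization.mk_zero]

/-- The value at the generic point of a section of `𝒪(d)` over a nonempty open set, as an element
of the fraction field. -/
def gen {d : ℤ} {U : (P3 k).Opens} (hU : genericPt k ∈ U) : Γ(O k d, U) →+ FracField k where
  toFun f := fiberToField _ (Subtype.val
    (p := (SerreTwist.isLocallyFraction (coordGrading k) d).pred) f ⟨genericPt k, hU⟩)
  map_zero' := map_zero (fiberToField _)
  map_add' _ _ := map_add (fiberToField _) _ _

/-- The section `f` of `𝒪(d)` as a function with values in the local rings. -/
def fiberValues {d : ℤ} {U : (P3 k).Opens} (f : Γ(O k d, U)) :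
    (SerreTwist.sheafInType (coordGrading k) d).obj.obj (op U) := f

theorem gen_map {d : ℤ} {U V : (P3 k).Opens} (hU : genericPt k ∈ U) (hV : genericPt k ∈ V)
    (i : V ⟶ U) (f : Γ(O k d, U)) : gen hV ((O k d).presheaf.map i.op f) = gen hU f :=
  rfl

/-- The definition of a section of `𝒪(d)`, with the open sets taken in the scheme `ℙ³`. -/
theorem exists_fraction {d : ℤ} {U : (P3 k).Opens} (f : Γ(O k d, U)) {x : P3 k} (hx : x ∈ U) :
    ∃ (V : (P3 k).Opens) (_ : x ∈ V) (hVU : V ≤ U) (i j : ℕ) (r s : MvPolynomial (Fin 4) k),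
      (i : ℤ) = j + d ∧ r.IsHomogeneous i ∧ s.IsHomogeneous j ∧
      ∃ hs : ∀ y : P3 k, y ∈ V → s ∈ SerreTwist.compl (𝒜 := coordGrading k) y,
      ∀ (y : P3 k) (hy : y ∈ V), (fiberValues f).1 ⟨y, hVU hy⟩ = Localization.mk r ⟨s, hs y hy⟩ := by
  obtain ⟨V, hxV, i, a, b, e, r, s, hs, w⟩ := (fiberValues f).2 ⟨x, hx⟩
  exact ⟨V, hxV, leOfHom i, a, b, r, s, e, r.2, s.2, fun y hy => hs ⟨y, hy⟩, fun y hy => w ⟨y, hy⟩⟩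

theorem isRegularAt_gen {d : ℤ} {U : (P3 k).Opens} (hU : genericPt k ∈ U) (f : Γ(O k d, U))
    {x : P3 k} (hx : x ∈ U) : IsRegularAt d x (gen hU f) := by
  obtain ⟨V, hxV, hVU, i, j, r, s, hij, hr, hs, hsx, w⟩ := exists_fraction f hx
  exact ⟨i, j, r, s, hij, hr, hs, hsx x hxV, (congrArg (fiberToField _)
    (w (genericPt k) (genericPt_mem hxV))).trans (fiberToField_mk _ _ _)⟩

/-- The value of a section at any point of its domain, read in the fraction field, is its value at
the generic point. -/
theorem gen_eq {d : ℤ} {U : (P3 k).Opens} (hU : genericPt k ∈ U) (f : Γ(O k d, U))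
    {x : P3 k} (hx : x ∈ U) : gen hU f = fiberToField x ((fiberValues f).1 ⟨x, hx⟩) := by
  obtain ⟨V, hxV, hVU, i, j, r, s, hij, hr, hs, hsx, w⟩ := exists_fraction f hx
  refine (congrArg (fiberToField _) (w (genericPt k) (genericPt_mem hxV))).trans ?_
  exact (fiberToField_mk _ _ _).trans
    ((congrArg (fiberToField x) (w x hxV)).trans (fiberToField_mk _ _ _)).symm

theorem gen_injective {d : ℤ} {U : (P3 k).Opens} (hU : genericPt k ∈ U) :
    Function.Injective (gen hU : Γ(O k d, U) →+ FracField k) := fun f g h =>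
  Subtype.ext <| funext fun x => fiberToField_injective _ <|
    (gen_eq hU f x.2).symm.trans (h.trans (gen_eq hU g x.2))

/-- The section of `𝒪(d)` given by a fraction of homogeneous polynomials. -/
def fracSection {d : ℤ} (U : (P3 k).Opens) {i j : ℕ} {r s : MvPolynomial (Fin 4) k}
    (hij : (i : ℤ) = j + d) (hr : r.IsHomogeneous i) (hs : s.IsHomogeneous j)
    (hU : ∀ y : P3 k, y ∈ U → s ∈ SerreTwist.compl (𝒜 := coordGrading k) y) : Γ(O k d, U) :=
  (⟨fun y => Localization.mk r ⟨s, hU y.1 y.2⟩, fun y => ⟨U, y.2, 𝟙 _, i, j, hij, ⟨r, hr⟩,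
    ⟨s, hs⟩, fun z => hU z.1 z.2, fun _ => rfl⟩⟩ :
    (SerreTwist.sheafInType (coordGrading k) d).obj.obj (op U))

theorem gen_fracSection {d : ℤ} {U : (P3 k).Opens} (hη : genericPt k ∈ U) {i j : ℕ}
    {r s : MvPolynomial (Fin 4) k} (hij : (i : ℤ) = j + d) (hr : r.IsHomogeneous i)
    (hs : s.IsHomogeneous j)
    (hU : ∀ y : P3 k, y ∈ U → s ∈ SerreTwist.compl (𝒜 := coordGrading k) y) :
    gen hη (fracSection U hij hr hs hU) =
      algebraMap _ (FracField k) r / algebraMap _ (FracField k) s :=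
  fiberToField_mk _ _ _

/-- The regular function given by a fraction of homogeneous polynomials of the same degree. -/
def fracFunction (U : (P3 k).Opens) {i : ℕ} {r s : MvPolynomial (Fin 4) k}
    (hr : r.IsHomogeneous i) (hs : s.IsHomogeneous i)
    (hU : ∀ y : P3 k, y ∈ U → s ∈ SerreTwist.compl (𝒜 := coordGrading k) y) : Γ(P3 k, U) :=
  (⟨fun y => HomogeneousLocalization.mk ⟨i, ⟨r, hr⟩, ⟨s, hs⟩, hU y.1 y.2⟩, fun y => ⟨U, y.2, 𝟙 _, i,
    ⟨r, hr⟩, ⟨s, hs⟩, fun z => hU z.1 z.2, fun _ => rfl⟩⟩ :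
    (ProjectiveSpectrum.Proj.structureSheaf (coordGrading k)).obj.obj (op U))

theorem gen_fracFunction_smul {d : ℤ} {U : (P3 k).Opens} (hη : genericPt k ∈ U) {i : ℕ}
    {r s : MvPolynomial (Fin 4) k} (hr : r.IsHomogeneous i) (hs : s.IsHomogeneous i)
    (hU : ∀ y : P3 k, y ∈ U → s ∈ SerreTwist.compl (𝒜 := coordGrading k) y) (f : Γ(O k d, U)) :
    gen hη (fracFunction U hr hs hU • f) =
      algebraMap _ (FracField k) r / algebraMap _ (FracField k) s * gen hη f := by
  refine (map_mul (fiberToField _) _ _).trans ?_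
  congr 1
  exact (congrArg (fiberToField _) (HomogeneousLocalization.val_mk _)).trans (fiberToField_mk _ _ _)

/-- The open set where a coordinate does not vanish. -/
def coordOpen (i : Fin 4) : (P3 k).Opens :=
  ProjectiveSpectrum.basicOpen (coordGrading k) (MvPolynomial.X i)

theorem mem_coordOpen {i : Fin 4} {x : P3 k} : x ∈ coordOpen (k := k) i ↔
    (MvPolynomial.X i : MvPolynomial (Fin 4) k) ∈ SerreTwist.compl (𝒜 := coordGrading k) x :=
  Iff.rfl

theorem exists_mem_coordOpen (x : P3 k) : ∃ i, x ∈ coordOpen (k := k) i :=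
  exists_X_mem_compl x

theorem genericPt_mem_coordOpen (i : Fin 4) : genericPt k ∈ coordOpen (k := k) i := by
  intro h
  have : (MvPolynomial.X i : MvPolynomial (Fin 4) k) ∈ (⊥ : Ideal (MvPolynomial (Fin 4) k)) := h
  simp at this

/-! ### Morphisms between line bundles are multiplications -/

section Multiplier

variable {Y : Scheme.{u}} (j : Y ⟶ P3 k) [IsOpenImmersion j] {d e : ℤ}

/-- The action on sections of a morphism between restrictions to an open subscheme. -/
def resApp {M N : (P3 k).Modules} (φ : M.restrict j ⟶ N.restrict j) (W : Y.Opens) :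
    Γ(M, j ''ᵁ W) →+ Γ(N, j ''ᵁ W) :=
  (φ.app W).hom

theorem resApp_smul {M N : (P3 k).Modules} (φ : M.restrict j ⟶ N.restrict j) (W : Y.Opens)
    (a : Γ(P3 k, j ''ᵁ W)) (f : Γ(M, j ''ᵁ W)) : resApp j φ W (a • f) = a • resApp j φ W f := by
  obtain ⟨b, rfl⟩ : ∃ b, (j.appIso W).inv b = a := ⟨(j.appIso W).hom a, by simp⟩
  exact φ.app_smul b f

theorem resApp_map {M N : (P3 k).Modules} (φ : M.restrict j ⟶ N.restrict j) {V W : Y.Opens}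
    (h : V ≤ W) (f : Γ(M, j ''ᵁ W)) :
    resApp j φ V (M.presheaf.map (homOfLE (j.image_mono h)).op f) =
      N.presheaf.map (homOfLE (j.image_mono h)).op (resApp j φ W f) :=
  ConcreteCategory.congr_hom (φ.mapPresheaf.naturality (homOfLE h).op) f

/-- The morphism `φ : 𝒪(d) ⟶ 𝒪(e)` over an open subscheme is multiplication by the rational
function `h` on sections. -/
def IsMultiplier (φ : (O k d).restrict j ⟶ (O k e).restrict j) (h : FracField k) : Prop :=
  ∀ (W : Y.Opens) (hW : genericPt k ∈ j ''ᵁ W) (f : Γ(O k d, j ''ᵁ W)),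
    gen hW (resApp j φ W f) = h * gen hW f

theorem gen_resApp_map (φ : (O k d).restrict j ⟶ (O k e).restrict j) {V W : Y.Opens} (h : V ≤ W)
    (hV : genericPt k ∈ j ''ᵁ V) (hW : genericPt k ∈ j ''ᵁ W) (f : Γ(O k d, j ''ᵁ W)) :
    gen hV (resApp j φ V ((O k d).presheaf.map (homOfLE (j.image_mono h)).op f)) =
      gen hW (resApp j φ W f) := by
  rw [resApp_map j φ h, gen_map hW hV]

/-- The section `Xᵢ ^ d` of `𝒪(d)` where the coordinate `Xᵢ` does not vanish. -/
def coordSection (d : ℤ) (i : Fin 4) {U : (P3 k).Opens} (hU : U ≤ coordOpen i) : Γ(O k d, U) :=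
  fracSection U (i := d.toNat) (j := (-d).toNat) (r := MvPolynomial.X i ^ d.toNat)
    (s := MvPolynomial.X i ^ (-d).toNat) (by omega) (MvPolynomial.isHomogeneous_X_pow _ _)
    (MvPolynomial.isHomogeneous_X_pow _ _) fun y hy =>
      (SerreTwist.compl (𝒜 := coordGrading k) y).pow_mem (mem_coordOpen.1 (hU hy)) _

theorem gen_coordSection (d : ℤ) (i : Fin 4) {U : (P3 k).Opens} (hU : U ≤ coordOpen i)
    (hη : genericPt k ∈ U) : gen hη (coordSection d i hU) =
      algebraMap (MvPolynomial (Fin 4) k) (FracField k) (MvPolynomial.X i ^ d.toNat) /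
        algebraMap (MvPolynomial (Fin 4) k) (FracField k) (MvPolynomial.X i ^ (-d).toNat) :=
  gen_fracSection _ _ _ _ _

theorem gen_coordSection_ne_zero (d : ℤ) (i : Fin 4) {U : (P3 k).Opens} (hU : U ≤ coordOpen i)
    (hη : genericPt k ∈ U) : gen hη (coordSection d i hU) ≠ 0 := by
  have hX := algebraMap_ne_zero_of_mem_compl (hU hη)
  rw [gen_coordSection, map_pow, map_pow]
  exact div_ne_zero (pow_ne_zero _ hX) (pow_ne_zero _ hX)

theorem mem_image_preimage {x : P3 k} {U : (P3 k).Opens} (hx : x ∈ j.opensRange) (hU : x ∈ U) :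
    x ∈ j ''ᵁ (j ⁻¹ᵁ U) := by
  obtain ⟨y, rfl⟩ := hx
  exact ⟨y, hU, rfl⟩

variable {j}

/-- Near a point where `Xᵢ` does not vanish, the multiplier is the image of `Xᵢ ^ d` divided
by `Xᵢ ^ d`. -/
theorem IsMultiplier.isRegularAt {φ : (O k d).restrict j ⟶ (O k e).restrict j} {h : FracField k}
    (hφ : IsMultiplier j φ h) {x : P3 k} (hx : x ∈ j.opensRange) : IsRegularAt (e - d) x h := by
  obtain ⟨i, hi⟩ := exists_mem_coordOpen x
  have hxU := mem_image_preimage j hx hi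
  have hη := genericPt_mem hxU
  let f : Γ(O k d, j ''ᵁ (j ⁻¹ᵁ coordOpen i)) := coordSection d i (j.image_preimage_le _)
  have h1 := hφ _ hη f
  obtain ⟨a, b, r, s, hab, hr, hs, hsx, he⟩ := isRegularAt_gen hη (resApp j φ _ f) hxU
  rw [h1, gen_coordSection] at he
  have hX := algebraMap_ne_zero_of_mem_compl hi
  have hs0 := algebraMap_ne_zero_of_mem_compl hsx
  refine ⟨a + (-d).toNat, b + d.toNat, r * MvPolynomial.X i ^ (-d).toNat,
    s * MvPolynomial.X i ^ d.toNat, by omega, hr.mul (MvPolynomial.isHomogeneous_X_pow _ _),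
    hs.mul (MvPolynomial.isHomogeneous_X_pow _ _),
    Submonoid.mul_mem _ hsx (Submonoid.pow_mem _ hi _), ?_⟩
  rw [map_pow, map_pow, mul_div_assoc', div_eq_div_iff (pow_ne_zero _ hX) hs0] at he
  rw [eq_div_iff (by rw [map_mul, map_pow]; exact mul_ne_zero hs0 (pow_ne_zero _ hX)),
    map_mul, map_mul, map_pow, map_pow, ← he]
  ring

variable (j) in
/-- Generically every section is a multiple of `X₀ ^ d` by a rational function of degree zero, so a
linear map is determined by the image of `X₀ ^ d`. -/
theorem exists_isMultiplier (hj : genericPt k ∈ j.opensRange)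
    (φ : (O k d).restrict j ⟶ (O k e).restrict j) : ∃ h, IsMultiplier j φ h := by
  have hη := mem_image_preimage j hj (genericPt_mem_coordOpen 0)
  let f₀ : Γ(O k d, j ''ᵁ (j ⁻¹ᵁ coordOpen 0)) := coordSection d 0 (j.image_preimage_le _)
  have hX := algebraMap_ne_zero_of_mem_compl (genericPt_mem_coordOpen (k := k) 0)
  refine ⟨gen hη (resApp j φ _ f₀) / gen hη f₀, fun W hW f => ?_⟩
  obtain ⟨V, hηV, hVU, a, b, r, s, hab, hr, hs, hsV, w⟩ := exists_fraction f hW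
  -- Over a small open set `f` is a multiple of `f₀` by a regular function.
  let W' : Y.Opens := W ⊓ j ⁻¹ᵁ coordOpen 0 ⊓ j ⁻¹ᵁ V
  have h1 : W' ≤ W := inf_le_left.trans inf_le_left
  have h2 : W' ≤ j ⁻¹ᵁ coordOpen 0 := inf_le_left.trans inf_le_right
  have hW' : genericPt k ∈ j ''ᵁ W' := by
    obtain ⟨y, hy, hyη⟩ := hW
    exact ⟨y, ⟨⟨hy, show j y ∈ coordOpen 0 from hyη ▸ genericPt_mem_coordOpen 0⟩,
      show j y ∈ V from hyη ▸ hηV⟩, hyη⟩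
  have hf : gen hW f = algebraMap _ (FracField k) r / algebraMap _ (FracField k) s :=
    (congrArg (fiberToField _) (w (genericPt k) hηV)).trans (fiberToField_mk _ _ _)
  have hs0 := algebraMap_ne_zero_of_mem_compl (hsV _ hηV)
  let g : Γ(P3 k, j ''ᵁ W') := fracFunction (j ''ᵁ W') (i := a + (-d).toNat)
    (r := r * MvPolynomial.X 0 ^ (-d).toNat) (s := s * MvPolynomial.X 0 ^ d.toNat)
    (hr.mul (MvPolynomial.isHomogeneous_X_pow _ _))
    (by
      have : a + (-d).toNat = b + d.toNat := by omega
      exact this ▸ hs.mul (MvPolynomial.isHomogeneous_X_pow _ _))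
    (by
      rintro _ ⟨y, hy, rfl⟩
      exact (SerreTwist.compl (𝒜 := coordGrading k) (j y)).mul_mem (hsV _ hy.2)
        ((SerreTwist.compl (𝒜 := coordGrading k) (j y)).pow_mem hy.1.2 _))
  have key : (O k d).presheaf.map (homOfLE (j.image_mono h1)).op f =
      g • (O k d).presheaf.map (homOfLE (j.image_mono h2)).op f₀ := by
    apply gen_injective hW'
    rw [gen_fracFunction_smul, gen_map hW hW', gen_map hη hW', hf, gen_coordSection, map_mul,
      map_mul, map_pow, map_pow]
    field_simp
  rw [← gen_resApp_map j φ h1 hW' hW f, key,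
    resApp_smul, gen_fracFunction_smul,
    gen_resApp_map j φ h2 hW' hη f₀, hf, gen_coordSection,
    map_mul, map_mul, map_pow, map_pow]
  field_simp

end Multiplier

section Mult

variable {Y : Scheme.{u}} (j : Y ⟶ P3 k) [IsOpenImmersion j] {d e c : ℤ}

theorem IsMultiplier.unique {j : Y ⟶ P3 k} [IsOpenImmersion j] (hj : genericPt k ∈ j.opensRange)
    {φ : (O k d).restrict j ⟶ (O k e).restrict j} {h h' : FracField k}
    (hφ : IsMultiplier j φ h) (hφ' : IsMultiplier j φ h') : h = h' := by
  have hη := mem_image_preimage j hj (genericPt_mem_coordOpen 0)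
  let f₀ : Γ(O k d, j ''ᵁ (j ⁻¹ᵁ coordOpen 0)) := coordSection d 0 (j.image_preimage_le _)
  exact mul_right_cancel₀ (gen_coordSection_ne_zero d 0 _ hη) ((hφ _ hη f₀).symm.trans (hφ' _ hη f₀))

variable (hj : genericPt k ∈ j.opensRange)

/-- The rational function by which a morphism `𝒪(d) ⟶ 𝒪(e)` over a nonempty open subscheme
multiplies. -/
def mult : ((O k d).restrict j ⟶ (O k e).restrict j) →+ FracField k :=
  AddMonoidHom.mk' (fun φ => (exists_isMultiplier j hj φ).choose) fun φ ψ =>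
    IsMultiplier.unique hj (exists_isMultiplier j hj (φ + ψ)).choose_spec fun W hW f => by
      rw [add_mul, ← (exists_isMultiplier j hj φ).choose_spec W hW f,
        ← (exists_isMultiplier j hj ψ).choose_spec W hW f, ← map_add]
      rfl

theorem isMultiplier_mult (φ : (O k d).restrict j ⟶ (O k e).restrict j) :
    IsMultiplier j φ (mult j hj φ) :=
  (exists_isMultiplier j hj φ).choose_spec

theorem mult_eq {φ : (O k d).restrict j ⟶ (O k e).restrict j} {h : FracField k}
    (hφ : IsMultiplier j φ h) : mult j hj φ = h :=
  (isMultiplier_mult j hj φ).unique hj hφ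

theorem mult_id : mult j hj (𝟙 ((O k d).restrict j)) = 1 :=
  mult_eq j hj fun _ _ _ => (one_mul _).symm

theorem mult_comp (φ : (O k d).restrict j ⟶ (O k e).restrict j)
    (ψ : (O k e).restrict j ⟶ (O k c).restrict j) :
    mult j hj (φ ≫ ψ) = mult j hj φ * mult j hj ψ :=
  mult_eq j hj fun W hW f => by
    rw [mul_comm (mult j hj φ), mul_assoc, ← isMultiplier_mult j hj φ W hW f,
      ← isMultiplier_mult j hj ψ W hW _]
    rfl

variable (k) in
theorem genericPt_mem_opensRange_id : genericPt k ∈ Scheme.Hom.opensRange (𝟙 (P3 k)) := ⟨_, rfl⟩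

/-- The rational function by which a morphism `𝒪(d) ⟶ 𝒪(e)` multiplies. -/
def globalMult (φ : O k d ⟶ O k e) : FracField k :=
  mult (𝟙 _) (genericPt_mem_opensRange_id k) ((restrictFunctor (𝟙 _)).map φ)

theorem app_map {M N : (P3 k).Modules} (φ : M ⟶ N) {V W : (P3 k).Opens} (i : V ⟶ W)
    (z : Γ(M, W)) : φ.app V (M.presheaf.map i.op z) = N.presheaf.map i.op (φ.app W z) :=
  ConcreteCategory.congr_hom (φ.mapPresheaf.naturality i.op) z

theorem isMultiplier_map_iff {φ : O k d ⟶ O k e} {h : FracField k} :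
    IsMultiplier j ((restrictFunctor j).map φ) h ↔ ∀ (W : Y.Opens)
      (hW : genericPt k ∈ j ''ᵁ W) (f : Γ(O k d, j ''ᵁ W)),
      gen hW (φ.app (j ''ᵁ W) f) = h * gen hW f :=
  Iff.rfl

theorem gen_app (φ : O k d ⟶ O k e) {V : (P3 k).Opens} (hV : genericPt k ∈ V) (f : Γ(O k d, V)) :
    gen hV (φ.app V f) = globalMult φ * gen hV f := by
  have hle : (𝟙 (P3 k)) ''ᵁ V ≤ V := by simp
  have hW : genericPt k ∈ (𝟙 (P3 k)) ''ᵁ V := by simpa using hV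
  rw [← gen_map hV hW (homOfLE hle), ← app_map, ← gen_map hV hW (homOfLE hle) f]
  exact (isMultiplier_map_iff _).1 (isMultiplier_mult _ (genericPt_mem_opensRange_id k) _) V hW _

theorem mult_map (φ : O k d ⟶ O k e) : mult j hj ((restrictFunctor j).map φ) = globalMult φ :=
  mult_eq j hj fun _ hW f => gen_app φ hW f

theorem isRegularAt_globalMult (φ : O k d ⟶ O k e) (x : P3 k) :
    IsRegularAt (e - d) x (globalMult φ) :=
  (isMultiplier_mult (𝟙 _) _ _).isRegularAt ⟨x, rfl⟩

/-- An open set without the generic point is empty. -/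
theorem section_eq_zero {d : ℤ} {V : (P3 k).Opens} (hV : genericPt k ∉ V) (f : Γ(O k d, V)) :
    f = 0 :=
  Subtype.ext <| funext fun x => (hV (genericPt_mem x.2)).elim

theorem eq_zero_of_globalMult_eq_zero {φ : O k d ⟶ O k e} (h : globalMult φ = 0) : φ = 0 := by
  ext V f
  by_cases hV : genericPt k ∈ V
  · refine gen_injective hV ((gen_app φ hV f).trans ?_)
    rw [h, zero_mul]
    exact (map_zero _).symm
  · exact (section_eq_zero hV _).trans (section_eq_zero hV _).symm

theorem eq_zero_of_lt (h : e < d) (φ : O k d ⟶ O k e) : φ = 0 :=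
  eq_zero_of_globalMult_eq_zero
    (eq_zero_of_isRegularAt_of_neg (sub_neg.2 h) (isRegularAt_globalMult φ))

/-- The endomorphisms of `𝒪(d)` are the multiplications by constants. -/
theorem isIso_of_ne_zero {φ : O k d ⟶ O k d} (hφ : φ ≠ 0) : IsIso φ := by
  obtain ⟨a, ha⟩ := exists_eq_C_of_isRegularAt_zero
    fun x => sub_self d ▸ isRegularAt_globalMult φ x
  have ha0 : a ≠ 0 := by
    rintro rfl
    exact hφ (eq_zero_of_globalMult_eq_zero (ha.trans (by simp)))
  have hC : algebraMap (MvPolynomial (Fin 4) k) (FracField k) (MvPolynomial.C a) ≠ 0 := by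
    simpa using ha0
  rw [Hom.isIso_iff_isIso_app]
  intro V
  rw [ConcreteCategory.isIso_iff_bijective]
  by_cases hV : genericPt k ∈ V
  · constructor
    · intro f g hfg
      apply gen_injective hV
      have := congrArg (gen hV) hfg
      rw [gen_app, gen_app, ha] at this
      exact mul_left_cancel₀ hC this
    · intro f
      refine ⟨fracFunction V (MvPolynomial.isHomogeneous_C _ a⁻¹)
        (MvPolynomial.isHomogeneous_one _ _) (fun y _ => Submonoid.one_mem _) • f,
        gen_injective hV ?_⟩
      rw [gen_app, gen_fracFunction_smul, ha, ← mul_assoc, ← mul_div_assoc, ← map_mul, ← map_mul,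
        mul_inv_cancel₀ ha0]
      simp
  · exact ⟨fun f g _ => (section_eq_zero hV f).trans (section_eq_zero hV g).symm,
      fun f => ⟨0, (section_eq_zero hV _).trans (section_eq_zero hV f).symm⟩⟩

end Mult

/-! ### Morphisms between sums of line bundles as matrices -/

section Matrix

variable {Y : Scheme.{u}} (j : Y ⟶ P3 k) [IsOpenImmersion j] (hj : genericPt k ∈ j.opensRange)
variable {ι κ μ : Type} [Fintype ι] [Fintype κ] [Fintype μ]
  {a : ι → ℤ} {b : κ → ℤ} {c : μ → ℤ}

instance additive_restrictFunctor : (restrictFunctor j).Additive where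
  map_add := rfl

/-- The matrix of rational functions of a morphism between sums of line bundles over a nonempty
open subscheme; morphisms compose as matrices acting on row vectors. -/
def toMatrix (φ : (split k a).restrict j ⟶ (split k b).restrict j) : Matrix ι κ (FracField k) :=
  Matrix.of fun i l => mult j hj ((restrictFunctor j).map (biproduct.ι (fun i => O k (a i)) i) ≫ φ ≫
    (restrictFunctor j).map (biproduct.π (fun l => O k (b l)) l))

theorem map_total : ∑ l, (restrictFunctor j).map (biproduct.π (fun l => O k (b l)) l) ≫
    (restrictFunctor j).map (biproduct.ι (fun l => O k (b l)) l) =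
      𝟙 ((restrictFunctor j).obj (split k b)) := by
  simp_rw [← Functor.map_comp]
  rw [← Functor.map_sum, biproduct.total, CategoryTheory.Functor.map_id]

theorem toMatrix_comp (φ : (split k a).restrict j ⟶ (split k b).restrict j)
    (ψ : (split k b).restrict j ⟶ (split k c).restrict j) :
    toMatrix j hj (φ ≫ ψ) = toMatrix j hj φ * toMatrix j hj ψ := by
  ext i l
  rw [Matrix.mul_apply]
  simp only [toMatrix, Matrix.of_apply]
  simp_rw [← mult_comp]
  rw [← map_sum]
  congr 1
  simp only [Category.assoc]
  rw [← Preadditive.comp_sum, ← Preadditive.comp_sum]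
  congr 2
  simp_rw [← Category.assoc (restrictFunctor j |>.map (biproduct.π _ _))]
  rw [← Preadditive.sum_comp, map_total, Category.id_comp]

theorem mult_map_ι_π [DecidableEq κ] (l l' : κ) : mult j hj
    ((restrictFunctor j).map (biproduct.ι (fun l => O k (b l)) l) ≫
      (restrictFunctor j).map (biproduct.π (fun l => O k (b l)) l')) =
        (1 : Matrix κ κ (FracField k)) l l' := by
  rw [← Functor.map_comp]
  by_cases h : l = l'
  · subst h
    rw [biproduct.ι_π_self, CategoryTheory.Functor.map_id, Matrix.one_apply_eq]
    exact mult_id j hj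
  · rw [biproduct.ι_π_ne _ h, Functor.map_zero, map_zero, Matrix.one_apply_ne h]

theorem toMatrix_id [DecidableEq κ] : toMatrix j hj (𝟙 ((split k b).restrict j)) = 1 := by
  ext l l'
  rw [← mult_map_ι_π (b := b) j hj l l']
  simp [toMatrix]

/-- The matrix of a morphism defined on all of `ℙ³` does not depend on the open subscheme. -/
theorem toMatrix_map (φ : split k a ⟶ split k b) :
    toMatrix j hj ((restrictFunctor j).map φ) =
      Matrix.of fun i l => globalMult (biproduct.ι (fun i => O k (a i)) i ≫ φ ≫
        biproduct.π (fun l => O k (b l)) l) := by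
  ext i l
  simp only [toMatrix, Matrix.of_apply]
  rw [← mult_map j hj, Functor.map_comp, Functor.map_comp]

end Matrix

/-! ### Summands of large degree -/

section Destabilize

variable {ι κ : Type} [Fintype ι] [Fintype κ] {c : ι → ℤ} {b : κ → ℤ}

/-- If `e` is the `l₀`-th unit row vector, then `e = e R B` and `B R' = 1` give `e R' = e R`. -/
theorem row_eq_of_one_row_eq {K : Type*} [Field K] [DecidableEq ι] [DecidableEq κ] {l₀ : κ}
    {R R' : Matrix κ ι K} {B : Matrix ι κ K} (h : ∀ l, (1 : Matrix κ κ K) l₀ l = (R * B) l₀ l)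
    (hB : B * R' = 1) (i : ι) : R' l₀ i = R l₀ i := by
  calc R' l₀ i = ((1 : Matrix κ κ K) * R') l₀ i := by rw [Matrix.one_mul]
    _ = (R * B * R') l₀ i := by rw [Matrix.mul_apply, Matrix.mul_apply]; simp_rw [h]
    _ = R l₀ i := by rw [Matrix.mul_assoc, hB, Matrix.mul_one]

/-- A summand `𝒪(b l₀)` of the target of a locally split `β` meets the image of `β` trivially if
its degree exceeds all degrees of the source. Otherwise its generator `e` is generically in the
image of `β`, and for a local left inverse `r` the coefficients `e r` of its preimage do not depend
on `r`; they are therefore regular everywhere, of negative degree, and vanish. -/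
theorem eq_zero_of_comp_ι_eq {β : split k c ⟶ split k b} (hβ : IsLocallyLeftInvertible β)
    (l₀ : κ) (hlt : ∀ i, c i < b l₀) {T : (P3 k).Modules} {g : T ⟶ O k (b l₀)} {t : T ⟶ split k c}
    (h : g ≫ biproduct.ι (fun l => O k (b l)) l₀ = t ≫ β) : g = 0 := by
  classical
  by_contra hg
  obtain ⟨V, z, hz⟩ : ∃ (V : (P3 k).Opens) (z : Γ(T, V)), g.app V z ≠ 0 := by
    by_contra! H
    refine hg ?_
    ext V z
    exact H V z
  have hV : genericPt k ∈ V := by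
    by_contra hV
    exact hz (section_eq_zero hV _)
  have hgz : gen hV (g.app V z) ≠ 0 := fun h0 =>
    hz (gen_injective hV (h0.trans (map_zero _).symm))
  obtain ⟨U, hU, ⟨⟨r, hr⟩⟩⟩ := hβ (genericPt k)
  have hj : genericPt k ∈ U.ι.opensRange := by simpa using hU
  have hW := mem_image_preimage U.ι hj hV
  let z' : Γ(T, U.ι ''ᵁ (U.ι ⁻¹ᵁ V)) := T.presheaf.map (homOfLE (U.ι.image_preimage_le V)).op z
  have hz' : gen hW (g.app _ z') = gen hV (g.app V z) := by
    rw [app_map, gen_map hV hW]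
  let F := restrictFunctor U.ι
  -- Generically the generator of the summand is fixed by the idempotent `r ≫ β`.
  have hrow : ∀ l, (1 : Matrix κ κ (FracField k)) l₀ l =
      (toMatrix U.ι hj r * toMatrix U.ι hj (F.map β)) l₀ l := by
    intro l
    rw [← toMatrix_comp, ← mult_map_ι_π U.ι hj]
    simp only [toMatrix, Matrix.of_apply]
    rw [← sub_eq_zero, ← map_sub]
    set ψ := F.map (biproduct.ι (fun l => O k (b l)) l₀) ≫ F.map (biproduct.π (fun l => O k (b l)) l) -
      F.map (biproduct.ι (fun l => O k (b l)) l₀) ≫ (r ≫ F.map β) ≫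
        F.map (biproduct.π (fun l => O k (b l)) l) with hψ
    -- On the image of `g` both terms agree, because it lies in the image of `β`.
    have h0 : F.map g ≫ ψ = 0 := by
      rw [hψ, Preadditive.comp_sub, ← Category.assoc, ← Category.assoc (F.map g), ← F.map_comp, h,
        F.map_comp]
      simp only [Category.assoc]
      rw [reassoc_of% hr, sub_self]
    have h1 := isMultiplier_mult U.ι hj ψ (U.ι ⁻¹ᵁ V) hW (g.app _ z')
    have h2 : resApp U.ι ψ (U.ι ⁻¹ᵁ V) (g.app _ z') = 0 :=
      ConcreteCategory.congr_hom (congrArg (fun χ => Hom.app χ (U.ι ⁻¹ᵁ V)) h0) z'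
    rw [h2, map_zero, hz'] at h1
    exact (mul_eq_zero.1 h1.symm).resolve_right hgz
  have hzero : ∀ i, toMatrix U.ι hj r l₀ i = 0 := by
    intro i
    refine eq_zero_of_isRegularAt_of_neg (sub_neg.2 (hlt i)) fun x => ?_
    obtain ⟨U', hU', ⟨⟨r', hr'⟩⟩⟩ := hβ x
    have hj' : genericPt k ∈ U'.ι.opensRange := by simpa using genericPt_mem hU'
    have hBR := toMatrix_comp U'.ι hj' ((restrictFunctor U'.ι).map β) r'
    rw [hr', toMatrix_map, ← toMatrix_map U.ι hj] at hBR
    have hBR' : toMatrix U.ι hj (F.map β) * toMatrix U'.ι hj' r' = 1 :=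
      hBR.symm.trans (toMatrix_id U'.ι hj')
    rw [← row_eq_of_one_row_eq hrow hBR' i]
    exact (isMultiplier_mult U'.ι hj' _).isRegularAt (by simpa using hU')
  have h1 := hrow l₀
  rw [Matrix.one_apply_eq, Matrix.mul_apply] at h1
  simp [hzero] at h1

/-- If no summand of the target has larger degree than `𝒪(b l₀)`, then the components of the
morphism on `𝒪(b l₀)` vanish or are isomorphisms, so that the image is zero or a summand. -/
theorem ι_comp_eq_zero {α : split k b ⟶ split k c} {l₀ : κ} (hle : ∀ i, c i ≤ b l₀)
    (hα : ¬ ImageIsSummand (biproduct.ι (fun l => O k (b l)) l₀ ≫ α)) :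
    biproduct.ι (fun l => O k (b l)) l₀ ≫ α = 0 := by
  set f := biproduct.ι (fun l => O k (b l)) l₀ ≫ α
  by_contra hf
  obtain ⟨i, hi⟩ : ∃ i, f ≫ biproduct.π (fun i => O k (c i)) i ≠ 0 := by
    by_contra! H
    exact hf (biproduct.hom_ext _ _ fun i => (H i).trans zero_comp.symm)
  have hc : c i = b l₀ := (hle i).eq_of_not_lt fun hlt => hi (eq_zero_of_lt hlt _)
  have : IsSplitMono f := by
    have hiso : IsIso (f ≫ biproduct.π (fun i => O k (c i)) i) := by
      revert hi
      generalize f ≫ biproduct.π (fun i => O k (c i)) i = φ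
      revert φ
      rw [hc]
      exact fun φ hφ => isIso_of_ne_zero hφ
    exact ⟨⟨⟨biproduct.π (fun i => O k (c i)) i ≫ inv (f ≫ biproduct.π (fun i => O k (c i)) i), by
      rw [← Category.assoc, IsIso.hom_inv_id]⟩⟩⟩
  refine hα ⟨fun h0 => hf ?_, ⟨⟨⟨retraction f ≫ factorThruImage f, ?_⟩⟩⟩⟩
  · rw [← image.fac f, h0.eq_of_tgt (factorThruImage f) 0, zero_comp]
  · rw [← cancel_epi (factorThruImage f), image.fac_assoc, IsSplitMono.id_assoc, Category.comp_id]

end Destabilize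

/-! ### Rank and first Chern class of the cohomology of a monad -/

section ThreeTerm

open scoped ZeroObject

variable {C : Type*} [Category* C] [Abelian C] (S : ShortComplex C)

/-- The objects of the cochain complex with the terms of `S` in degrees `-1`, `0` and `1`. -/
def threeTermX : ℤ → C
  | .negSucc 0 => S.X₁
  | .ofNat 0 => S.X₂
  | .ofNat 1 => S.X₃
  | _ => 0

/-- The differentials of the cochain complex with the terms of `S` in degrees `-1`, `0`
and `1`. -/
def threeTermD : ∀ n : ℤ, threeTermX S n ⟶ threeTermX S (n + 1)
  | .negSucc 0 => S.f
  | .ofNat 0 => S.g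
  | .ofNat (_ + 1) => 0
  | .negSucc (_ + 1) => 0

/-- The cochain complex with the terms of `S` in degrees `-1`, `0` and `1`. -/
def threeTerm : CochainComplex C ℤ :=
  CochainComplex.of (threeTermX S) (threeTermD S) fun n => match n with
    | .negSucc 0 => S.zero
    | .ofNat 0 => comp_zero
    | .ofNat (_ + 1) => zero_comp
    | .negSucc (_ + 1) => zero_comp

theorem isZero_threeTerm_X {i : ℤ} (h₁ : i ≠ -1) (h₂ : i ≠ 0) (h₃ : i ≠ 1) :
    IsZero ((threeTerm S).X i) :=
  match i with
  | .negSucc 0 => absurd rfl h₁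
  | .negSucc (_ + 1) => isZero_zero C
  | .ofNat 0 => absurd rfl h₂
  | .ofNat 1 => absurd rfl h₃
  | .ofNat (_ + 2) => isZero_zero C

theorem threeTerm_d_neg_one : (threeTerm S).d (.negSucc 0) 0 = S.f :=
  CochainComplex.of_d (threeTermX S) (threeTermD S) (.negSucc 0)

theorem threeTerm_d_zero : (threeTerm S).d 0 1 = S.g :=
  CochainComplex.of_d (threeTermX S) (threeTermD S) 0

theorem exactAt_threeTerm [Mono S.f] [Epi S.g] {i : ℤ} (hi : i ≠ 0) : (threeTerm S).ExactAt i := by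
  by_cases h₁ : i = -1
  · subst h₁
    rw [HomologicalComplex.exactAt_iff' _ (-2) (-1) 0 (by simp) (by simp),
      ShortComplex.exact_iff_mono _ ((isZero_threeTerm_X S (i := -2) (by simp) (by simp)
        (by simp)).eq_of_src _ _)]
    change Mono ((threeTerm S).d (.negSucc 0) 0)
    rw [threeTerm_d_neg_one]
    exact ‹Mono S.f›
  by_cases h₃ : i = 1
  · subst h₃
    rw [HomologicalComplex.exactAt_iff' _ 0 1 2 (by simp) (by simp),
      ShortComplex.exact_iff_epi _ ((isZero_threeTerm_X S (i := 2) (by simp) (by simp)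
        (by simp)).eq_of_tgt _ _)]
    change Epi ((threeTerm S).d 0 1)
    rw [threeTerm_d_zero]
    exact ‹Epi S.g›
  · exact ShortComplex.exact_of_isZero_X₂ _ (isZero_threeTerm_X S h₁ hi h₃)

/-- The cohomology of the three-term complex in degree zero is that of `S`. -/
def threeTermHomologyIso : (threeTerm S).homology 0 ≅ S.homology :=
  (threeTerm S).homologyIsoSc' (.negSucc 0) 0 1 (by simp) (by simp) ≪≫
    ShortComplex.homologyMapIso (ShortComplex.isoMk (S₁ := (threeTerm S).sc' (.negSucc 0) 0 1) (S₂ := S)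
      (Iso.refl S.X₁) (Iso.refl S.X₂) (Iso.refl S.X₃)
      ((Category.id_comp _).trans ((threeTerm_d_neg_one S).symm.trans (Category.comp_id _).symm))
      ((Category.id_comp _).trans ((threeTerm_d_zero S).symm.trans (Category.comp_id _).symm)))

end ThreeTerm

theorem isZero_split {ι : Type} [Finite ι] (hι : IsEmpty ι) (d : ι → ℤ) : IsZero (split k d) := by
  rw [IsZero.iff_id_eq_zero]
  exact biproduct.hom_ext _ _ fun i => (hι.false i).elim

theorem exists_list_split_iso {ι : Type} [Fintype ι] (d : ι → ℤ) :
    ∃ l : List ℤ, l.length = Fintype.card ι ∧ l.sum = ∑ i, d i ∧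
      Nonempty (split k d ≅ split k l.get) := by
  let e := Fintype.equivFin ι
  refine ⟨List.ofFn (d ∘ e.symm), by simp, ?_, ⟨(biproduct.whiskerEquiv
    ((finCongr List.length_ofFn).trans e.symm) fun i => eqToIso ?_).symm⟩⟩
  · rw [List.sum_ofFn]
    exact e.symm.sum_comp d
  · simp
    rfl

/-- The monad, placed in degrees `-1`, `0` and `1`, computes the rank and the first Chern class of
its cohomology. -/
theorem hasRankAndC1_of_iso {ι κ μ : Type} [Fintype ι] [Fintype κ] [Fintype μ] {a : ι → ℤ}
    {b : κ → ℤ} {c : μ → ℤ} (f : split k a ⟶ split k b) (g : split k b ⟶ split k c) (w : f ≫ g = 0)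
    [Mono f] [Epi g] {F : (P3 k).Modules} (e : (ShortComplex.mk f g w).homology ≅ F) :
    HasRankAndC1 F (Fintype.card κ - Fintype.card ι - Fintype.card μ)
      (∑ l, b l - ∑ i, a i - ∑ m, c m) := by
  obtain ⟨la, hla, hla', ⟨ea⟩⟩ := exists_list_split_iso (k := k) a
  obtain ⟨lb, hlb, hlb', ⟨eb⟩⟩ := exists_list_split_iso (k := k) b
  obtain ⟨lc, hlc, hlc', ⟨ec⟩⟩ := exists_list_split_iso (k := k) c
  have hIcc : Finset.Icc (-((1 : ℕ) : ℤ)) (1 : ℕ) = {-1, 0, 1} := by decide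
  refine ⟨threeTerm (ShortComplex.mk f g w), 1, fun i => if i = -1 then la else if i = 0 then lb
    else if i = 1 then lc else [], ?_, ?_, fun i hi => ?_,
    ⟨threeTermHomologyIso _ ≪≫ e⟩, ?_, ?_⟩
  · intro i
    by_cases h₁ : i = -1
    · subst h₁; exact ⟨ea⟩
    by_cases h₂ : i = 0
    · subst h₂; exact ⟨eb⟩
    by_cases h₃ : i = 1
    · subst h₃; exact ⟨ec⟩
    · exact ⟨(isZero_threeTerm_X _ h₁ h₂ h₃).iso
        (isZero_split ⟨fun j => absurd j.2 (by simp [h₁, h₂, h₃])⟩ _)⟩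
  · intro i hi
    simp only [hIcc, Finset.mem_insert, Finset.mem_singleton, not_or] at hi
    simp [hi]
  · have : Mono (ShortComplex.mk f g w).f := ‹Mono f›
    have : Epi (ShortComplex.mk f g w).g := ‹Epi g›
    exact exactAt_threeTerm _ hi
  · rw [hIcc]
    simp [hla, hlb, hlc]
    ring
  · rw [hIcc]
    simp [hla', hlb', hlc']
    ring

theorem hasRankAndC1_O (d : ℤ) : HasRankAndC1 (O k d) 1 d := by
  have h0 : IsZero (split k (Fin.elim0 : Fin 0 → ℤ)) := isZero_split inferInstance _
  let f : split k (Fin.elim0 : Fin 0 → ℤ) ⟶ split k (fun _ : Unit => d) := 0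
  let g : split k (fun _ : Unit => d) ⟶ split k (Fin.elim0 : Fin 0 → ℤ) := 0
  have : Mono f := ⟨fun _ _ _ => h0.eq_of_tgt _ _⟩
  have : Epi g := ⟨fun _ _ _ => h0.eq_of_src _ _⟩
  simpa using hasRankAndC1_of_iso f g zero_comp
    ((ShortComplex.HomologyData.ofZeros (ShortComplex.mk f g zero_comp) rfl rfl).left.homologyIso ≪≫
      biproductUniqueIso (fun _ : Unit => O k d))

/-! ### Destabilizing line subbundles -/

namespace Monad

variable {s : ℕ} {a : Fin s → ℤ} {b : Fin (s + 1) → ℤ}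

/-- The cohomology bundle of a monad of the given shape has rank two and `c₁ = -1`. -/
theorem hasRankAndC1_cohomology (M : Monad k a b) : HasRankAndC1 M.cohomology 2 (-1) := by
  have := M.mono_β
  have := M.epi_α
  convert hasRankAndC1_of_iso M.β M.α M.comp_eq_zero (Iso.refl _) using 1
  · rfl
  · rw [Fintype.card_sum, Fintype.card_fin, Fintype.card_fin]
    push_cast
    ring
  · rw [Fintype.sum_sum_type]
    simp only [Sum.elim_inl, Sum.elim_inr, Finset.sum_sub_distrib, Finset.sum_neg_distrib]
    simp
    ring

/-- A summand `𝒪(b l₀)` of the middle term whose degree is at least all `a i` and exceeds all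
`-a i - 1` is a subsheaf of the cohomology bundle of a minimal monad: minimality puts it into
`ker α`, and it meets the image of `β` trivially. -/
theorem exists_mono_cohomology (M : Monad k a b) (hM : M.IsMinimal) (l₀ : Fin (s + 1))
    (hle : ∀ i, a i ≤ b l₀) (hlt : ∀ i, -a i - 1 < b l₀) :
    ∃ i : O k (b l₀) ⟶ M.cohomology, Mono i := by
  let b' : Fin (s + 1) ⊕ Fin (s + 1) → ℤ := Sum.elim b fun j => -b j - 1
  let ι₀ : O k (b l₀) ⟶ split k b' := biproduct.ι (fun l => O k (b' l)) (Sum.inl l₀)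
  have hsplit : IsLocallyLeftInvertible ι₀ := fun x => by
    have : IsSplitMono ι₀ := inferInstanceAs (IsSplitMono (biproduct.ι _ _))
    exact ⟨⊤, trivial, inferInstance⟩
  have hα : ι₀ ≫ M.α = 0 :=
    ι_comp_eq_zero (b := b') (l₀ := Sum.inl l₀) hle (hM.1 _ ι₀ hsplit)
  let S := ShortComplex.mk M.β M.α M.comp_eq_zero
  refine ⟨S.liftCycles ι₀ hα ≫ S.homologyπ, Preadditive.mono_of_cancel_zero _ fun {T} g hg => ?_⟩
  have hg' : (g ≫ S.liftCycles ι₀ hα) ≫ S.homologyπ = 0 := (Category.assoc _ _ _).trans hg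
  have hβ : Mono S.toCycles := by
    have := M.mono_β
    have h : S.toCycles ≫ S.iCycles = M.β := S.toCycles_i
    have : Mono (S.toCycles ≫ S.iCycles) := h ▸ this
    exact mono_of_mono _ S.iCycles
  have hexact : (ShortComplex.mk S.toCycles S.homologyπ S.toCycles_comp_homologyπ).Exact :=
    ShortComplex.exact_of_g_is_cokernel _ S.homologyIsCokernel
  have : Mono (ShortComplex.mk S.toCycles S.homologyπ S.toCycles_comp_homologyπ).f := hβ
  have hfac := hexact.lift_f (g ≫ S.liftCycles ι₀ hα) hg'
  refine eq_zero_of_comp_ι_eq (b := b') M.locallyLeftInvertible_β (Sum.inl l₀) hlt (g := g)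
    (t := hexact.lift (g ≫ S.liftCycles ι₀ hα) hg') ?_
  have := congrArg (· ≫ S.iCycles) hfac
  simp only [Category.assoc, S.liftCycles_i, S.toCycles_i] at this
  exact this.symm

/-- The subsheaf `𝒪(b l₀)` has slope `b l₀`, and the cohomology bundle has slope `-1/2`. -/
theorem not_isStable_cohomology (M : Monad k a b) (hM : M.IsMinimal) (l₀ : Fin (s + 1))
    (hle : ∀ i, a i ≤ b l₀) (hlt : ∀ i, -a i - 1 < b l₀) (hb : 0 ≤ b l₀) :
    ¬ IsStable M.cohomology := by
  intro hE
  obtain ⟨i, hi⟩ := M.exists_mono_cohomology hM l₀ hle hlt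
  have := hE.2 2 (-1) M.hasRankAndC1_cohomology _ i hi 1 (b l₀) (hasRankAndC1_O _) (by simp)
    (by simp)
  omega

end Monad

end P3

end

end AlgebraicGeometry

open AlgebraicGeometry in
theorem lemma6p1 (k : Type*) [Field k] :
    (∀ M : P3.Monad k ![2, 2] ![0, 0, 2], M.IsMinimal → ¬ P3.IsStable M.cohomology) ∧
    (∀ M : P3.Monad k ![1, 2, 2] ![0, 0, 0, 2], M.IsMinimal → ¬ P3.IsStable M.cohomology) ∧
    (∀ M : P3.Monad k ![2, 2, 2] ![0, 1, 1, 2], M.IsMinimal → ¬ P3.IsStable M.cohomology) := by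
  refine ⟨fun M hM => M.not_isStable_cohomology hM 2 ?_ ?_ ?_,
    fun M hM => M.not_isStable_cohomology hM 3 ?_ ?_ ?_,
    fun M hM => M.not_isStable_cohomology hM 3 ?_ ?_ ?_⟩ <;> decide
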